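/- Let $\mathbb K$ be a field of characteristic $0$, let $n\in\mathbb N$, $\Gamma=(\mathbb Z_2)^n$, $\langle\gamma,\delta\rangle=\sum_i\gamma_i\delta_i\in\mathbb Z_2$, and let $A=\bigoplus_{\gamma\in\Gamma}A^\gamma$ be an associative unital $\Gamma$-graded $\mathbb K$-algebra that is graded commutative: $ba=(-1)^{\langle\gamma,\delta\rangle}ab$ for $a\in A^\gamma$, $b\in A^\delta$. A degree $\gamma$ is even if $\langle\gamma,\gamma\rangle=0$ and odd if $\langle\gamma,\gamma\rangle=1$. Let $\mathbf r=(r_\gamma)_{\gamma\in\Gamma}\in\mathbb N^\Gamma$. Let $\mathsf M^0(\mathbf r;A)$ be the ring of square matrices with $r_\gamma$ rows and $r_\gamma$ columns of degree $\gamma$ for each $\gamma$, in which every entry in a row of degree $\gamma$ and a column of degree $\delta$ lies in $A^{\gamma+\delta}$, and let $\mathsf{GL}^0(\mathbf r;A)$ be its group of invertible elements. Separating even and odd rows and columns, write $X\in\mathsf M^0(\mathbf r;A)$ as $X=\begin{pmatrix}X_{11}&X_{12}\\X_{21}&X_{22}\end{pmatrix}$, where $X_{11}$ is the even-even and $X_{22}$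 the odd-odd block. If $X_{22}$ is invertible, put $|X|_{11}=X_{11}-X_{12}X_{22}^{-1}X_{21}$. For a square matrix $Y=(y_{ij})$ of degree $0$ in the above sense whose row and column degrees are all even, or all odd, the graded determinant is $$\Gamma\!\det(Y)=\sum_{\sigma}\operatorname{sgn}(\sigma)\prod_{(i_1\,i_2\cdots i_m)}y_{i_1i_2}y_{i_2i_3}\cdots y_{i_mi_1}\in A^0,$$ where $\sigma$ runs through the permutations of the indices and the product is over the cycles $i_1\mapsto i_2\mapsto\cdots\mapsto i_m\mapsto i_1$ of $\sigma$, fixed points included (each factor lies in the commutative ring $A^0$ and does not depend on the starting point of the cycle). Then the following hold. (a) On the degree $0$ matrices with all index degrees even, and likewise on those with all index degrees odd (with the degrees and multiplicities given by $\mathbf r$), $\Gamma\!\det$ is multiplicative; it equals the product of the (ordinary) determinants of the diagonal blocks on matrices that are block-diagonal with respect to the degrees $\gamma\in\Gamma$; and it equals $1$ on matrices that are block-unitriangular with respect to the degrees, for any ordering of $\Gamma$. (b) For every $X\in\mathsf{GL}^0(\mathbf r;A)$, the blocks $X_{11}$ and $X_{22}$ are invertible, and $\Gamma\!\det(X_{11})$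 and $\Gamma\!\det(X_{22})$ are units of $A^0$. (c) There is a unique group homomorphism $\Gamma\mathrm{ber}:\mathsf{GL}^0(\mathbf r;A)\to(A^0)^\times$ such that 1. $\Gamma\mathrm{ber}(X)=\Gamma\!\det(X_{11})\cdot\Gamma\!\det(X_{22})^{-1}$ for every $X\in\mathsf{GL}^0(\mathbf r;A)$ with $X_{12}=0$ and $X_{21}=0$; 2. $\Gamma\mathrm{ber}(X)=1$ for every $X\in\mathsf{GL}^0(\mathbf r;A)$ with $X_{11}$ and $X_{22}$ identity matrices and $X_{12}=0$ or $X_{21}=0$. (d) For every $X\in\mathsf{GL}^0(\mathbf r;A)$, $$\Gamma\mathrm{ber}(X)=\Gamma\!\det(|X|_{11})\cdot\Gamma\!\det(X_{22})^{-1}.$$ -/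

import Mathlib

open scoped BigOperators

namespace ColorBer

/-- The grading group `(ℤ/2)^n`. -/
abbrev Gr (n : ℕ) : Type := Fin n → ZMod 2

/-- The parity `⟨γ, γ⟩ ∈ ℤ/2` of a degree, for the standard scalar product of `(ℤ/2)^n`;
`γ` is even if it is `0` and odd if it is `1`. -/
def parity {n : ℕ} (γ : Gr n) : ZMod 2 := γ ⬝ᵥ γ

/-- Graded commutativity: `b a = (-1)^⟨γ, δ⟩ a b` for `a` of degree `γ` and `b` of degree `δ`. -/
class IsGradedComm {K A : Type*} [Field K] [Ring A] [Algebra K A] {n : ℕ}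
    (𝒜 : Gr n → Submodule K A) : Prop where
  comm : ∀ {γ δ : Gr n} {a b : A}, a ∈ 𝒜 γ → b ∈ 𝒜 δ →
    b * a = (-1 : A) ^ (γ ⬝ᵥ δ).val * (a * b)

theorem gr_add_self {n : ℕ} (γ : Gr n) : γ + γ = 0 := by
  funext i
  exact CharTwo.add_self_eq_zero (γ i)

theorem gr_add_cancel {n : ℕ} (α β γ : Gr n) : (α + β) + (β + γ) = α + γ := by
  rw [add_assoc, ← add_assoc β β γ, gr_add_self, zero_add]

section

variable {K A : Type*} [Field K] [Ring A] [Algebra K A] {n : ℕ}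
  (𝒜 : Gr n → Submodule K A) [GradedAlgebra 𝒜]

/-- The degree zero part of a graded commutative algebra is a commutative ring. -/
instance gradeZeroCommRing [IsGradedComm 𝒜] : CommRing (𝒜 0) :=
  { (inferInstance : Ring (𝒜 0)) with
    mul_comm := by
      intro a b
      apply Subtype.ext
      have h := IsGradedComm.comm (𝒜 := 𝒜) b.2 a.2
      simpa using h }

section

variable {ι : Type*} [Fintype ι] [DecidableEq ι] (w : ι → Gr n)

theorem mul_entry_mem {κ ρ τ : Type*} [Fintype ρ] (u : κ → Gr n) (v : ρ → Gr n) (x : τ → Gr n)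
    (X : Matrix κ ρ A) (Y : Matrix ρ τ A)
    (hX : ∀ i j, X i j ∈ 𝒜 (u i + v j)) (hY : ∀ i j, Y i j ∈ 𝒜 (v i + x j)) (i : κ) (j : τ) :
    (X * Y) i j ∈ 𝒜 (u i + x j) := by
  rw [Matrix.mul_apply]
  refine Submodule.sum_mem _ fun k _ => ?_
  have h := SetLike.mul_mem_graded (hX i k) (hY k j)
  rwa [gr_add_cancel] at h

/-- The ring of square matrices of degree `0` whose rows and columns carry the degrees `w`:
the entry `(i, j)` has degree `w i + w j` (which is `-w i + w j` in `(ℤ/2)^n`). -/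
def degZero : Subring (Matrix ι ι A) where
  carrier := {X | ∀ i j, X i j ∈ 𝒜 (w i + w j)}
  mul_mem' := fun {X Y} hX hY i j => mul_entry_mem 𝒜 w w w X Y hX hY i j
  one_mem' := by
    intro i j
    by_cases h : i = j
    · subst h
      rw [Matrix.one_apply_eq, gr_add_self]
      exact SetLike.one_mem_graded 𝒜
    · rw [Matrix.one_apply_ne h]
      exact Submodule.zero_mem _
  add_mem' := fun {X Y} hX hY i j => Submodule.add_mem _ (hX i j) (hY i j)
  zero_mem' := fun i j => Submodule.zero_mem _
  neg_mem' := fun {X} hX i j => Submodule.neg_mem _ (hX i j)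

variable {w}

theorem path_mem (X : degZero 𝒜 w) (σ : Equiv.Perm ι) (i : ι) (m : ℕ) :
    ((List.range m).map fun k => X.1 ((σ ^ k) i) ((σ ^ (k + 1)) i)).prod
      ∈ 𝒜 (w i + w ((σ ^ m) i)) := by
  induction m with
  | zero =>
    simp only [List.range_zero, List.map_nil, List.prod_nil, pow_zero, Equiv.Perm.one_apply,
      gr_add_self]
    exact SetLike.one_mem_graded 𝒜
  | succ m ih =>
    rw [List.range_succ, List.map_append, List.prod_append]
    have h := SetLike.mul_mem_graded ih (X.2 ((σ ^ m) i) ((σ ^ (m + 1)) i))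
    rw [gr_add_cancel] at h
    simpa using h

/-- The ordered product `x_{i₁ i₂} x_{i₂ i₃} ⋯ x_{i_m i₁}` along the cycle
`i₁ ↦ i₂ ↦ ⋯ ↦ i_m ↦ i₁` of `σ` through `i₁ = i` (for a fixed point `i` it is `x_{i i}`).
It has degree zero. -/
noncomputable def cycleProd (X : degZero 𝒜 w) (σ : Equiv.Perm ι) (i : ι) : 𝒜 0 :=
  ⟨((List.range (Function.minimalPeriod σ i)).map
      fun k => X.1 ((σ ^ k) i) ((σ ^ (k + 1)) i)).prod, by
    have h := path_mem 𝒜 X σ i (Function.minimalPeriod σ i)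
    have e : (σ ^ Function.minimalPeriod σ i) i = i := by
      rw [← Equiv.Perm.iterate_eq_pow]
      exact Function.iterate_minimalPeriod
    rwa [e, gr_add_self] at h⟩

/-- The graded determinant of a matrix of degree zero all of whose entries have even degree (i.e.
all the degrees `w i` have the same parity): the polynomial
`∑ σ, sign σ * ∏ (cycles of σ) x_{i₁ i₂} x_{i₂ i₃} ⋯ x_{i_m i₁}`,
where the cycles include the fixed points. As the entries have even degree, the product
along a cycle does not depend on its starting point, and products along cycles are central. -/
noncomputable def gdet [IsGradedComm 𝒜] (X : degZero 𝒜 w) : 𝒜 0 := by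
  classical
  exact ∑ σ : Equiv.Perm ι, ((Equiv.Perm.sign σ : ℤˣ) : ℤ) •
    ∏ c : Quotient (Equiv.Perm.SameCycle.setoid σ), cycleProd 𝒜 X σ c.out

/-- The diagonal block of degree `γ`, formed by the rows and columns of degree `γ`; its entries
are in the commutative ring of elements of degree zero. -/
def gradedBlock (X : degZero 𝒜 w) (γ : Gr n) :
    Matrix {i : ι // w i = γ} {i : ι // w i = γ} (𝒜 0) :=
  fun i j => ⟨X.1 i.1 j.1, by
    have h := X.2 i.1 j.1
    rwa [i.2, j.2, gr_add_self] at h⟩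

/-- The three characteristic properties of the graded determinant on
degree zero matrices with all `w i` of the same parity: it is multiplicative, it is the
product of the determinants of the blocks on block-diagonal matrices, and it is `1` on
block-unitriangular ones, for each ordering of the degrees (here given by an injective `rk`;
reversing the order exchanges upper and lower). -/
def IsGradedDet [IsGradedComm 𝒜] (D : degZero 𝒜 w → 𝒜 0) : Prop :=
  (∀ X Y : degZero 𝒜 w, D (X * Y) = D X * D Y) ∧
  (∀ X : degZero 𝒜 w, (∀ i j, w i ≠ w j → X.1 i j = 0) →
    D X = ∏ γ : Gr n, (gradedBlock 𝒜 X γ).det) ∧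
  (∀ rk : Gr n → ℕ, Function.Injective rk → ∀ X : degZero 𝒜 w,
    (∀ i j, rk (w j) ≤ rk (w i) → X.1 i j = (1 : Matrix ι ι A) i j) → D X = 1)

end

/-- Row and column indices of matrices of rank `r`: there are `r γ` indices of degree `γ`. -/
abbrev Idx {n : ℕ} (r : Gr n → ℕ) : Type := Σ γ : Gr n, Fin (r γ)

/-- The indices of parity `ε` (`ε = 0`: even, `ε = 1`: odd). -/
abbrev PIdx {n : ℕ} (r : Gr n → ℕ) (ε : ZMod 2) : Type := {i : Idx r // parity i.1 = ε}

/-- The degree of an index. -/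
abbrev wt {n : ℕ} (r : Gr n → ℕ) : Idx r → Gr n := fun i => i.1

/-- The degree of an index of parity `ε`. -/
abbrev pwt {n : ℕ} (r : Gr n → ℕ) (ε : ZMod 2) : PIdx r ε → Gr n := fun i => i.1.1

/-- The group of invertible matrices of degree zero and rank `r`. -/
abbrev GL0 (r : Gr n → ℕ) : Type _ := (degZero 𝒜 (wt r))ˣ

variable {𝒜} {r : Gr n → ℕ}

/-- The blocks of the `2 × 2` decomposition of a matrix into even and odd rows and columns:
`blk X 0 0`, `blk X 0 1`, `blk X 1 0`, `blk X 1 1` are the blocks `X₁₁`, `X₁₂`, `X₂₁`, `X₂₂`. -/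
def blk (X : degZero 𝒜 (wt r)) (ε δ : ZMod 2) : Matrix (PIdx r ε) (PIdx r δ) A :=
  fun i j => X.1 i.1 j.1

/-- The diagonal blocks `X₁₁` (`ε = 0`) and `X₂₂` (`ε = 1`) as matrices of degree zero. -/
def diagBlk (X : degZero 𝒜 (wt r)) (ε : ZMod 2) : degZero 𝒜 (pwt r ε) :=
  ⟨blk X ε ε, fun i j => X.2 i.1 j.1⟩

/-- The quasideterminant `|X|₁₁ = X₁₁ - X₁₂ X₂₂⁻¹ X₂₁` of the `2 × 2` decomposition
(meaningful when `X₂₂` is invertible). -/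
noncomputable def quasidet (X : degZero 𝒜 (wt r)) : degZero 𝒜 (pwt r 0) :=
  ⟨blk X 0 0 - blk X 0 1 * (Ring.inverse (diagBlk X 1)).1 * blk X 1 0, fun i j =>
    Submodule.sub_mem _ (X.2 i.1 j.1)
      (mul_entry_mem 𝒜 (pwt r 0) (pwt r 1) (pwt r 0) _ _
        (mul_entry_mem 𝒜 (pwt r 0) (pwt r 1) (pwt r 1) _ _ (fun i j => X.2 i.1 j.1)
          (Ring.inverse (diagBlk X 1)).2)
        (fun i j => X.2 i.1 j.1) i j)⟩

/-- The two conditions that characterize the graded Berezinian among the group homomorphisms: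
its value on `2 × 2` block-diagonal matrices, and its triviality on upper and on lower `2 × 2`
block-unitriangular matrices. -/
def IsGradedBer [IsGradedComm 𝒜] (φ : GL0 𝒜 r →* (𝒜 0)ˣ) : Prop :=
  (∀ X : GL0 𝒜 r, blk X.1 0 1 = 0 → blk X.1 1 0 = 0 →
    (φ X : 𝒜 0) = gdet 𝒜 (diagBlk X.1 0) * Ring.inverse (gdet 𝒜 (diagBlk X.1 1))) ∧
  (∀ X : GL0 𝒜 r, blk X.1 0 0 = 1 → blk X.1 1 1 = 1 → blk X.1 0 1 = 0 → φ X = 1) ∧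
  (∀ X : GL0 𝒜 r, blk X.1 0 0 = 1 → blk X.1 1 1 = 1 → blk X.1 1 0 = 0 → φ X = 1)

end

end ColorBer

/-!
# The graded Berezinian

The graded determinant becomes an ordinary determinant after a change of the multiplication of
`A`. The bilinear form `cocycle γ δ = ∑_{i < j} γ_i δ_j` on `(ℤ/2)^n` satisfies
`cocycle γ δ + cocycle δ γ = ⟨γ, δ⟩ + parity γ * parity δ`, so that the twisted product
`(-1)^(cocycle γ δ) a b` is supercommutative, and commutative on elements of even degree. It is
realized by the operators `tw γ a` on `A`, which generate, for even `γ`, a commutative ring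
`evenTwist`. Multiplying the entry `(i, j)` of a matrix of degree zero by the sign
`(-1)^(cocycle (w i) (w i + w j))` makes the passage to twisted entries multiplicative
(`twMatrix_mul`). In a product along a closed path these signs cancel, whence the graded
determinant is the determinant of the twisted matrix (`zeroTwist_gdet`). Its three characteristic
properties follow from those of the determinant.

The invertibility of the diagonal blocks and the multiplicativity of the Berezinian both rest on
one fact about odd blocks: if `B` and `C` are off-diagonal blocks in opposite positions, then
`1 + B C` and `1 + C B` are invertible and `Γdet(1 + B C) Γdet(1 + C B) = 1`
(`hasInverseDets`). This property of `B`, required for all `C`, is additive in `B`, and it is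
clear if `B` has a single nonzero entry `b`, as `b ^ 2 = 0` for odd `b`.

If `X Y = 1`, then `X₁₁ Y₁₁ = 1 - X₁₂ Y₂₁` is invertible, and likewise for the odd blocks. For the
Berezinian of a product, put `C' = X₂₂⁻¹ X₂₁` and `B' = Y₁₂ Y₂₂⁻¹`; then
`(X Y)₂₂ = X₂₂ (1 + C' B') Y₂₂` and `|X Y|₁₁ = |X|₁₁ (1 + B' C')⁻¹ |Y|₁₁` (`schur_mul`), and the
two middle factors cancel. Uniqueness, with the formula for the Berezinian, comes from the
factorization of `X` into an upper unitriangular, a block-diagonal and a lower unitriangular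
matrix.
-/

namespace ColorBer

/-! ### The cocycle and its signs -/

/-- The sign `(-1)^z` of `z ∈ ℤ/2`, as an integer, so that it acts on every additive group. -/
def sgn (z : ZMod 2) : ℤ := (-1) ^ z.val

theorem sgn_zero : sgn 0 = 1 := rfl

theorem sgn_add (y z : ZMod 2) : sgn (y + z) = sgn y * sgn z := by
  revert y z; decide

theorem parity_eq_sum {n : ℕ} (γ : Gr n) : parity γ = ∑ i, γ i := by
  have h : ∀ z : ZMod 2, z * z = z := by decide
  simp [parity, dotProduct, h]

theorem parity_add {n : ℕ} (γ δ : Gr n) : parity (γ + δ) = parity γ + parity δ := by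
  simp [parity_eq_sum, Finset.sum_add_distrib]

/-- The bilinear form `∑_{i < j} γ_i δ_j` on `(ℤ/2)^n`. -/
def cocycle {n : ℕ} (γ δ : Gr n) : ZMod 2 := ∑ i, ∑ j, if i < j then γ i * δ j else 0

theorem cocycle_add_left {n : ℕ} (γ γ' δ : Gr n) :
    cocycle (γ + γ') δ = cocycle γ δ + cocycle γ' δ := by
  simp only [cocycle, ← Finset.sum_add_distrib]
  refine Finset.sum_congr rfl fun i _ => Finset.sum_congr rfl fun j _ => ?_
  split_ifs <;> simp [add_mul]

theorem cocycle_add_right {n : ℕ} (γ δ δ' : Gr n) :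
    cocycle γ (δ + δ') = cocycle γ δ + cocycle γ δ' := by
  simp only [cocycle, ← Finset.sum_add_distrib]
  refine Finset.sum_congr rfl fun i _ => Finset.sum_congr rfl fun j _ => ?_
  split_ifs <;> simp [mul_add]

theorem cocycle_zero_left {n : ℕ} (δ : Gr n) : cocycle 0 δ = 0 := by simp [cocycle]

theorem cocycle_zero_right {n : ℕ} (γ : Gr n) : cocycle γ 0 = 0 := by simp [cocycle]

/-- The antisymmetrization of the cocycle is the difference between the commutation form
`⟨γ, δ⟩` and the super commutation form `parity γ * parity δ`. -/
theorem cocycle_add_swap {n : ℕ} (γ δ : Gr n) :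
    cocycle γ δ + cocycle δ γ = γ ⬝ᵥ δ + parity γ * parity δ := by
  have h : cocycle δ γ = ∑ i, ∑ j, if j < i then γ i * δ j else 0 := by
    rw [cocycle, Finset.sum_comm]
    simp only [mul_comm]
  have h' : γ ⬝ᵥ δ = ∑ i, ∑ j, if i = j then γ i * δ j else 0 := by
    simp [dotProduct]
  rw [h, h', parity_eq_sum, parity_eq_sum, Finset.sum_mul_sum, cocycle]
  simp only [← Finset.sum_add_distrib]
  refine Finset.sum_congr rfl fun i _ => Finset.sum_congr rfl fun j _ => ?_
  rcases lt_trichotomy i j with hij | rfl | hij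
  · simp [hij, hij.ne, hij.not_gt]
  · simp [CharTwo.add_self_eq_zero]
  · simp [hij, hij.ne', hij.not_gt]

/-! ### Products along the cycles of a permutation -/

/-- A product over all indices is the product over the cycles of `σ` of the products along the
cycles. -/
theorem prod_eq_prod_cycles {ι R : Type*} [Fintype ι] [CommMonoid R] (σ : Equiv.Perm ι)
    (f : ι → R)
    [Fintype (Quotient (Equiv.Perm.SameCycle.setoid σ))] :
    ∏ i, f i = ∏ c : Quotient (Equiv.Perm.SameCycle.setoid σ),
      ∏ k ∈ Finset.range (Function.minimalPeriod σ c.out), f ((σ ^ k) c.out) := by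
  classical
  rw [← Finset.prod_fiberwise Finset.univ
    (fun i => (Quotient.mk (Equiv.Perm.SameCycle.setoid σ) i))]
  refine Finset.prod_congr rfl fun c _ => ?_
  symm
  refine Finset.prod_nbij (fun k => (σ ^ k) c.out) ?_ ?_ ?_ (fun _ _ => rfl)
  · intro k _
    rw [Finset.mem_filter]
    refine ⟨Finset.mem_univ _, ?_⟩
    conv_rhs => rw [← c.out_eq]
    exact Quotient.sound (Equiv.Perm.SameCycle.symm ⟨k, by simp⟩)
  · intro k hk l hl h
    simp only [Finset.coe_range, Set.mem_Iio] at hk hl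
    simp only [← Equiv.Perm.iterate_eq_pow] at h
    exact Function.iterate_injOn_Iio_minimalPeriod hk hl h
  · intro i hi
    have hi' : Equiv.Perm.SameCycle σ c.out i := by
      have h := (Finset.mem_filter.1 hi).2
      rw [← c.out_eq] at h
      exact Equiv.Perm.SameCycle.symm (Quotient.exact h)
    obtain ⟨m, -, hm⟩ := hi'.exists_pow_eq'
    have hp : 0 < Function.minimalPeriod σ c.out :=
      Function.minimalPeriod_pos_of_mem_periodicPts
        ((Equiv.injective σ).mem_periodicPts _)
    refine ⟨m % Function.minimalPeriod σ c.out, ?_, ?_⟩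
    · simpa using Nat.mod_lt _ hp
    · simp only [← Equiv.Perm.iterate_eq_pow] at hm ⊢
      rw [Function.iterate_mod_minimalPeriod_eq, hm]

/-! ### The twisted multiplication -/

open scoped IsMulCommutative

section

variable {K A : Type*} [Field K] [Ring A] [Algebra K A] {n : ℕ}
  (𝒜 : Gr n → Submodule K A) [GradedAlgebra 𝒜]

theorem end_ext_homogeneous {f g : Module.End K A} (h : ∀ δ, ∀ x ∈ 𝒜 δ, f x = g x) : f = g := by
  ext x
  induction x using DirectSum.Decomposition.inductionOn 𝒜 with
  | zero => simp
  | homogeneous m => exact h _ _ m.2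
  | add a b ha hb => rw [map_add, map_add, ha, hb]

/-- Twisted left multiplication by `a`, regarded as an element of degree `γ`: it sends `x` of
degree `δ` to `(-1)^(cocycle γ δ) a x`. -/
noncomputable def tw (γ : Gr n) (a : A) : Module.End K A :=
  LinearMap.mulLeft K a ∘ₗ ∑ δ, sgn (cocycle γ δ) • GradedAlgebra.proj 𝒜 δ

theorem tw_apply_of_mem (γ : Gr n) (a : A) {δ : Gr n} {x : A} (hx : x ∈ 𝒜 δ) :
    tw 𝒜 γ a x = sgn (cocycle γ δ) • (a * x) := by
  have h : ∀ δ', (GradedAlgebra.proj 𝒜 δ') x = if δ' = δ then x else 0 := by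
    intro δ'
    rw [GradedAlgebra.proj_apply]
    split_ifs with e
    · rw [e]; exact DirectSum.decompose_of_mem_same 𝒜 hx
    · exact DirectSum.decompose_of_mem_ne 𝒜 hx (Ne.symm e)
  simp only [tw, LinearMap.comp_apply, LinearMap.sum_apply, LinearMap.smul_apply, h, smul_ite,
    smul_zero, Finset.sum_ite_eq', Finset.mem_univ, if_true, map_zsmul, LinearMap.mulLeft_apply]

/-- A twisted multiplication determines its element. -/
theorem tw_apply_one (γ : Gr n) (a : A) : tw 𝒜 γ a 1 = a := by
  rw [tw_apply_of_mem 𝒜 γ a (SetLike.one_mem_graded 𝒜), cocycle_zero_right, sgn_zero, one_smul,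
    mul_one]

theorem tw_add (γ : Gr n) (a b : A) : tw 𝒜 γ (a + b) = tw 𝒜 γ a + tw 𝒜 γ b := by
  refine end_ext_homogeneous 𝒜 fun δ x hx => ?_
  simp only [LinearMap.add_apply, tw_apply_of_mem 𝒜 _ _ hx, add_mul, smul_add]

theorem tw_zero (γ : Gr n) : tw 𝒜 γ (0 : A) = 0 := by
  simpa using tw_add 𝒜 γ (0 : A) 0

theorem tw_sum {ι : Type*} (γ : Gr n) (s : Finset ι) (f : ι → A) :
    tw 𝒜 γ (∑ i ∈ s, f i) = ∑ i ∈ s, tw 𝒜 γ (f i) :=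
  map_sum (AddMonoidHom.mk' (tw 𝒜 γ) (tw_add 𝒜 γ)) f s

theorem tw_zsmul (γ : Gr n) (z : ℤ) (a : A) : tw 𝒜 γ (z • a) = z • tw 𝒜 γ a :=
  map_zsmul (AddMonoidHom.mk' (tw 𝒜 γ) (tw_add 𝒜 γ)) z a

theorem tw_zero_one : tw 𝒜 0 (1 : A) = 1 := by
  refine end_ext_homogeneous 𝒜 fun δ x hx => ?_
  simp [tw_apply_of_mem 𝒜 _ _ hx, cocycle_zero_left, sgn_zero]

theorem tw_mul_tw (γ : Gr n) (a : A) {δ : Gr n} {b : A} (hb : b ∈ 𝒜 δ) :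
    tw 𝒜 γ a * tw 𝒜 δ b = sgn (cocycle γ δ) • tw 𝒜 (γ + δ) (a * b) := by
  refine end_ext_homogeneous 𝒜 fun ε x hx => ?_
  rw [Module.End.mul_apply, LinearMap.smul_apply, tw_apply_of_mem 𝒜 _ _ hx,
    tw_apply_of_mem 𝒜 _ _ hx, map_zsmul, tw_apply_of_mem 𝒜 _ _ (SetLike.mul_mem_graded hb hx),
    smul_smul, smul_smul, mul_assoc, ← sgn_add, ← sgn_add, cocycle_add_left,
    cocycle_add_right]
  congr 2
  ring

theorem neg_one_pow_val_mul (z : ZMod 2) (a : A) : (-1 : A) ^ z.val * a = sgn z • a := by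
  simp [sgn, zsmul_eq_mul]

/-- Twisted multiplications commute as soon as one of the degrees is even. -/
theorem tw_commute [IsGradedComm 𝒜] {γ δ : Gr n} {a b : A} (ha : a ∈ 𝒜 γ) (hb : b ∈ 𝒜 δ)
    (hγ : parity γ = 0) : tw 𝒜 γ a * tw 𝒜 δ b = tw 𝒜 δ b * tw 𝒜 γ a := by
  rw [tw_mul_tw 𝒜 γ a hb, tw_mul_tw 𝒜 δ b ha, IsGradedComm.comm ha hb, neg_one_pow_val_mul,
    tw_zsmul, smul_smul, ← sgn_add, add_comm δ γ]
  have h := cocycle_add_swap γ δ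
  rw [hγ, zero_mul, add_zero] at h
  rw [← h, add_comm (cocycle γ δ), ← add_assoc, CharTwo.add_self_eq_zero, zero_add]

/-- The ring generated by the twisted multiplications by homogeneous elements of even degree. -/
noncomputable def evenTwist : Subring (Module.End K A) :=
  Subring.closure {f | ∃ γ : Gr n, parity γ = 0 ∧ ∃ a ∈ 𝒜 γ, f = tw 𝒜 γ a}

theorem tw_mem_evenTwist {γ : Gr n} (hγ : parity γ = 0) {a : A} (ha : a ∈ 𝒜 γ) :
    tw 𝒜 γ a ∈ evenTwist 𝒜 :=
  Subring.subset_closure ⟨γ, hγ, a, ha, rfl⟩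

instance evenTwist_isMulCommutative [IsGradedComm 𝒜] : IsMulCommutative (evenTwist 𝒜) :=
  Subring.isMulCommutative_closure (by
    rintro _ ⟨γ, hγ, a, ha, rfl⟩ _ ⟨δ, -, b, hb, rfl⟩
    exact tw_commute 𝒜 ha hb hγ)

theorem parity_zero : parity (0 : Gr n) = 0 := by simp [parity]

/-- The part of degree zero, embedded in the twisted even ring. -/
noncomputable def zeroTwist [IsGradedComm 𝒜] : 𝒜 0 →+* evenTwist 𝒜 where
  toFun a := ⟨tw 𝒜 0 a.1, tw_mem_evenTwist 𝒜 parity_zero a.2⟩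
  map_one' := Subtype.ext (tw_zero_one 𝒜)
  map_mul' a b := Subtype.ext (by
    have h := tw_mul_tw 𝒜 0 a.1 b.2
    rw [cocycle_zero_left, sgn_zero, one_smul, add_zero] at h
    exact h.symm)
  map_zero' := Subtype.ext (tw_zero 𝒜 0)
  map_add' a b := Subtype.ext (tw_add 𝒜 0 a.1 b.1)

theorem zeroTwist_injective [IsGradedComm 𝒜] : Function.Injective (zeroTwist 𝒜) := by
  intro a b h
  have h' := congrArg (fun f : evenTwist 𝒜 => f.1 1) h
  apply Subtype.ext
  simpa [zeroTwist, tw_apply_one] using h'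

/-! ### The graded determinant as a determinant over the twisted even ring -/

section Matrices

variable {ι : Type*} [Fintype ι] [DecidableEq ι] {w : ι → Gr n}

/-- The matrix over the twisted even ring attached to a matrix of degree zero with even entries.
The signs make the assignment multiplicative. -/
noncomputable def twMatrix (hw : ∀ i j, parity (w i + w j) = 0) (X : degZero 𝒜 w) :
    Matrix ι ι (evenTwist 𝒜) :=
  fun i j => ⟨sgn (cocycle (w i) (w i + w j)) • tw 𝒜 (w i + w j) (X.1 i j),
    zsmul_mem (tw_mem_evenTwist 𝒜 (hw i j) (X.2 i j)) _⟩

/-- Twisted matrix entries multiply without a sign along a path `i → j → k` of degrees. -/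
theorem tw_path_mul (i j k : Gr n) (a : A) {b : A} (hb : b ∈ 𝒜 (j + k)) :
    (sgn (cocycle i (i + j)) • tw 𝒜 (i + j) a) * (sgn (cocycle j (j + k)) • tw 𝒜 (j + k) b) =
      sgn (cocycle i (i + k)) • tw 𝒜 (i + k) (a * b) := by
  rw [smul_mul_smul_comm, tw_mul_tw 𝒜 _ _ hb, smul_smul, ← sgn_add, ← sgn_add, gr_add_cancel]
  congr 2
  rw [cocycle_add_left, ← gr_add_cancel i j k, cocycle_add_right i (i + j)]
  have h := CharTwo.add_self_eq_zero (cocycle j (j + k))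
  linear_combination h

theorem twMatrix_mul [IsGradedComm 𝒜] (hw : ∀ i j, parity (w i + w j) = 0) (X Y : degZero 𝒜 w) :
    twMatrix 𝒜 hw (X * Y) = twMatrix 𝒜 hw X * twMatrix 𝒜 hw Y := by
  ext i k : 1
  apply Subtype.ext
  rw [Matrix.mul_apply]
  have e : ∀ f : ι → evenTwist 𝒜, (∑ j, f j : evenTwist 𝒜).1 = ∑ j, (f j).1 := fun f =>
    map_sum (evenTwist 𝒜).subtype f _
  rw [e]
  have e' : ∀ j, (twMatrix 𝒜 hw X i j * twMatrix 𝒜 hw Y j k).1 =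
      sgn (cocycle (w i) (w i + w k)) • tw 𝒜 (w i + w k) (X.1 i j * Y.1 j k) := fun j =>
    tw_path_mul 𝒜 (w i) (w j) (w k) _ (Y.2 j k)
  simp only [e', ← Finset.smul_sum, ← tw_sum]
  rfl

theorem twMatrix_apply_of_eq [IsGradedComm 𝒜] (hw : ∀ i j, parity (w i + w j) = 0)
    (X : degZero 𝒜 w) {i j : ι} (h : w i = w j) (hX : X.1 i j ∈ 𝒜 0) :
    twMatrix 𝒜 hw X i j = zeroTwist 𝒜 ⟨X.1 i j, hX⟩ := by
  apply Subtype.ext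
  simp [twMatrix, zeroTwist, h, gr_add_self, cocycle_zero_right, sgn_zero]

theorem twMatrix_apply_eq_zero (hw : ∀ i j, parity (w i + w j) = 0)
    (X : degZero 𝒜 w) {i j : ι} (h : X.1 i j = 0) : twMatrix 𝒜 hw X i j = 0 := by
  apply Subtype.ext
  simp [twMatrix, h, tw_zero]

theorem twMatrix_apply_eq_one [IsGradedComm 𝒜] (hw : ∀ i j, parity (w i + w j) = 0)
    (X : degZero 𝒜 w) {i j : ι} (h : X.1 i j = (1 : Matrix ι ι A) i j) :
    twMatrix 𝒜 hw X i j = (1 : Matrix ι ι (evenTwist 𝒜)) i j := by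
  by_cases e : i = j
  · subst e
    rw [Matrix.one_apply_eq] at h ⊢
    apply Subtype.ext
    simp [twMatrix, h, gr_add_self, cocycle_zero_right, sgn_zero, tw_zero_one]
  · rw [Matrix.one_apply_ne e] at h ⊢
    exact twMatrix_apply_eq_zero 𝒜 hw X h

theorem zeroTwist_cycleProd [IsGradedComm 𝒜] (hw : ∀ i j, parity (w i + w j) = 0)
    (X : degZero 𝒜 w) (σ : Equiv.Perm ι) (i : ι) :
    zeroTwist 𝒜 (cycleProd 𝒜 X σ i) = ∏ k ∈ Finset.range (Function.minimalPeriod σ i),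
      twMatrix 𝒜 hw X ((σ ^ k) i) ((σ ^ (k + 1)) i) := by
  -- The product along an open path is, up to the sign of its endpoints, the twist of the ordered
  -- product; the sign disappears when the path closes up.
  have key : ∀ m : ℕ, (∏ k ∈ Finset.range m,
      twMatrix 𝒜 hw X ((σ ^ k) i) ((σ ^ (k + 1)) i) : evenTwist 𝒜).1 =
      sgn (cocycle (w i) (w i + w ((σ ^ m) i))) • tw 𝒜 (w i + w ((σ ^ m) i))
        ((List.range m).map fun k => X.1 ((σ ^ k) i) ((σ ^ (k + 1)) i)).prod := by
    intro m
    induction m with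
    | zero => simp [gr_add_self, cocycle_zero_right, sgn_zero, tw_zero_one]
    | succ m ih =>
      rw [Finset.prod_range_succ, Subring.coe_mul, ih, List.range_succ, List.map_append,
        List.prod_append, List.map_singleton, List.prod_singleton]
      exact tw_path_mul 𝒜 _ _ _ _ (X.2 _ _)
  apply Subtype.ext
  rw [key]
  have e : (σ ^ Function.minimalPeriod σ i) i = i := by
    rw [← Equiv.Perm.iterate_eq_pow]
    exact Function.iterate_minimalPeriod
  rw [e, gr_add_self, cocycle_zero_right, sgn_zero, one_smul]
  rfl

/-- The graded determinant is the ordinary determinant over the twisted even ring. -/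
theorem zeroTwist_gdet [IsGradedComm 𝒜] (hw : ∀ i j, parity (w i + w j) = 0)
    (X : degZero 𝒜 w) : zeroTwist 𝒜 (gdet 𝒜 X) = (twMatrix 𝒜 hw X).det := by
  classical
  -- `gdet` multiplies the entries `(i, σ i)`, and `Matrix.det` the entries `(σ i, i)`.
  rw [gdet, map_sum, ← Matrix.det_transpose, Matrix.det_apply']
  refine Finset.sum_congr rfl fun σ _ => ?_
  rw [map_zsmul, map_prod, zsmul_eq_mul]
  congr 1
  rw [prod_eq_prod_cycles σ]
  refine Finset.prod_congr rfl fun c _ => ?_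
  rw [zeroTwist_cycleProd 𝒜 hw]
  refine Finset.prod_congr rfl fun k _ => ?_
  rw [Matrix.transpose_apply, pow_succ', Equiv.Perm.mul_apply]

theorem gdet_mul [IsGradedComm 𝒜] (hw : ∀ i j, parity (w i + w j) = 0)
    (X Y : degZero 𝒜 w) : gdet 𝒜 (X * Y) = gdet 𝒜 X * gdet 𝒜 Y := by
  apply zeroTwist_injective 𝒜
  rw [map_mul, zeroTwist_gdet 𝒜 hw, zeroTwist_gdet 𝒜 hw, zeroTwist_gdet 𝒜 hw, twMatrix_mul,
    Matrix.det_mul]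

theorem gdet_one [IsGradedComm 𝒜] (hw : ∀ i j, parity (w i + w j) = 0) :
    gdet 𝒜 (1 : degZero 𝒜 w) = 1 := by
  apply zeroTwist_injective 𝒜
  have h : twMatrix 𝒜 hw 1 = 1 := by
    ext i j : 1
    exact twMatrix_apply_eq_one 𝒜 hw 1 rfl
  rw [zeroTwist_gdet 𝒜 hw, map_one, h, Matrix.det_one]

/-- The graded determinant of a matrix that differs from the identity only in the row `i`. -/
theorem gdet_of_row [IsGradedComm 𝒜] (hw : ∀ i j, parity (w i + w j) = 0) (X : degZero 𝒜 w)
    (i : ι) (h : ∀ k l, k ≠ i → X.1 k l = (1 : Matrix ι ι A) k l) (hi : X.1 i i ∈ 𝒜 0) :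
    gdet 𝒜 X = ⟨X.1 i i, hi⟩ := by
  apply zeroTwist_injective 𝒜
  have e : twMatrix 𝒜 hw X = (1 : Matrix ι ι _).updateRow i (twMatrix 𝒜 hw X i) := by
    ext k l : 1
    by_cases hk : k = i
    · subst hk; rw [Matrix.updateRow_self]
    · rw [Matrix.updateRow_ne hk]; exact twMatrix_apply_eq_one 𝒜 hw X (h k l hk)
  -- `Matrix.cramer` is the determinant as a function of the replaced column (here row).
  rw [zeroTwist_gdet 𝒜 hw, e, ← Matrix.cramer_transpose_apply, Matrix.transpose_one,
    Matrix.cramer_one]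
  exact twMatrix_apply_of_eq 𝒜 hw X rfl hi

/-- The graded determinant of a matrix that differs from the identity only in the column `i`. -/
theorem gdet_of_col [IsGradedComm 𝒜] (hw : ∀ i j, parity (w i + w j) = 0) (X : degZero 𝒜 w)
    (i : ι) (h : ∀ k l, l ≠ i → X.1 k l = (1 : Matrix ι ι A) k l) (hi : X.1 i i ∈ 𝒜 0) :
    gdet 𝒜 X = ⟨X.1 i i, hi⟩ := by
  apply zeroTwist_injective 𝒜
  have e : twMatrix 𝒜 hw X =
      (1 : Matrix ι ι _).updateCol i (fun k => twMatrix 𝒜 hw X k i) := by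
    ext k l : 1
    by_cases hl : l = i
    · subst hl; rw [Matrix.updateCol_self]
    · rw [Matrix.updateCol_ne hl]; exact twMatrix_apply_eq_one 𝒜 hw X (h k l hl)
  rw [zeroTwist_gdet 𝒜 hw, e, ← Matrix.cramer_apply, Matrix.cramer_one]
  exact twMatrix_apply_of_eq 𝒜 hw X rfl hi

theorem gdet_blockDiagonal [IsGradedComm 𝒜] (hw : ∀ i j, parity (w i + w j) = 0)
    (X : degZero 𝒜 w) (hX : ∀ i j, w i ≠ w j → X.1 i j = 0) :
    gdet 𝒜 X = ∏ γ : Gr n, (gradedBlock 𝒜 X γ).det := by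
  apply zeroTwist_injective 𝒜
  -- Any linear order on the degrees makes the matrix block triangular.
  let e := Fintype.equivFin (Gr n)
  have hT : (twMatrix 𝒜 hw X).BlockTriangular (fun i => e (w i)) := by
    intro i j hij
    exact twMatrix_apply_eq_zero 𝒜 hw X (hX i j fun h => by simp [h] at hij)
  rw [zeroTwist_gdet 𝒜 hw, hT.det_fintype, map_prod]
  refine (Fintype.prod_equiv e _ _ fun γ => ?_).symm
  rw [RingHom.map_det]
  let f : {i // w i = γ} ≃ {i // e (w i) = e γ} :=
    Equiv.subtypeEquivRight fun i => e.injective.eq_iff.symm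
  rw [← Matrix.det_submatrix_equiv_self f]
  congr 1
  ext i j : 1
  exact (twMatrix_apply_of_eq 𝒜 hw X (i.2.trans j.2.symm) (gradedBlock 𝒜 X γ i j).2).symm

theorem gdet_blockUnitriangular [IsGradedComm 𝒜] (hw : ∀ i j, parity (w i + w j) = 0)
    (rk : Gr n → ℕ) (X : degZero 𝒜 w)
    (hX : ∀ i j, rk (w j) ≤ rk (w i) → X.1 i j = (1 : Matrix ι ι A) i j) : gdet 𝒜 X = 1 := by
  apply zeroTwist_injective 𝒜
  have hT : (twMatrix 𝒜 hw X).BlockTriangular (fun i => rk (w i)) := by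
    intro i j hij
    rw [twMatrix_apply_eq_one 𝒜 hw X (hX i j hij.le), Matrix.one_apply_ne]
    rintro rfl
    exact lt_irrefl _ hij
  rw [zeroTwist_gdet 𝒜 hw, hT.det, map_one]
  refine Finset.prod_eq_one fun a _ => ?_
  have h : (twMatrix 𝒜 hw X).toSquareBlock (fun i => rk (w i)) a = 1 := by
    ext i j : 1
    rw [Matrix.toSquareBlock_def, Matrix.of_apply,
      twMatrix_apply_eq_one 𝒜 hw X (hX i j (j.2.trans i.2.symm).le)]
    simp [Matrix.one_apply, Subtype.ext_iff]
  rw [h, Matrix.det_one]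

theorem isGradedDet_gdet [IsGradedComm 𝒜] (hw : ∀ i j, parity (w i + w j) = 0) :
    IsGradedDet 𝒜 (gdet 𝒜 : degZero 𝒜 w → 𝒜 0) :=
  ⟨gdet_mul 𝒜 hw, gdet_blockDiagonal 𝒜 hw, fun rk _ X => gdet_blockUnitriangular 𝒜 hw rk X⟩

end Matrices

end

/-! ### Odd blocks -/

section

variable {K A : Type*} [Field K] [Ring A] [Algebra K A] {n : ℕ}
  (𝒜 : Gr n → Submodule K A)

theorem parity_add_of_eq {ε : ZMod 2} {γ δ : Gr n} (hγ : parity γ = ε) (hδ : parity δ = ε) :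
    parity (γ + δ) = 0 := by
  rw [parity_add, hγ, hδ, CharTwo.add_self_eq_zero]

/-- Elements `b` and `c` of the same odd degree anticommute; as `2` is invertible, `b ^ 2 = 0`,
and therefore `b c b = 0`. -/
theorem odd_mul_mul_self [CharZero K] [IsGradedComm 𝒜] {γ : Gr n} (hγ : parity γ = 1) {b c : A}
    (hb : b ∈ 𝒜 γ) (hc : c ∈ 𝒜 γ) : c * b = -(b * c) ∧ b * c * b = 0 := by
  have h1 : ∀ {x y : A}, x ∈ 𝒜 γ → y ∈ 𝒜 γ → y * x = -(x * y) := by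
    intro x y hx hy
    have h := IsGradedComm.comm (𝒜 := 𝒜) hx hy
    rw [show γ ⬝ᵥ γ = 1 from hγ] at h
    simpa [ZMod.val_one] using h
  have h2 : b * b = 0 := by
    have h := add_eq_zero_iff_eq_neg.2 (h1 hb hb)
    rw [← two_smul K] at h
    exact (smul_eq_zero_iff_right two_ne_zero).1 h
  refine ⟨h1 hb hc, ?_⟩
  rw [mul_assoc, h1 hb hc, mul_neg, ← mul_assoc, h2, zero_mul, neg_zero]

/-- A rectangular matrix of degree zero, with row degrees `w` and column degrees `v`. -/
def IsDegZero {ι κ : Type*} (w : ι → Gr n) (v : κ → Gr n) (B : Matrix ι κ A) : Prop :=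
  ∀ i j, B i j ∈ 𝒜 (w i + v j)

variable {𝒜} in
theorem IsDegZero.add {ι κ : Type*} {w : ι → Gr n} {v : κ → Gr n} {B B' : Matrix ι κ A}
    (hB : IsDegZero 𝒜 w v B) (hB' : IsDegZero 𝒜 w v B') : IsDegZero 𝒜 w v (B + B') :=
  fun i j => add_mem (hB i j) (hB' i j)

variable {𝒜} in
theorem IsDegZero.neg {ι κ : Type*} {w : ι → Gr n} {v : κ → Gr n} {B : Matrix ι κ A}
    (hB : IsDegZero 𝒜 w v B) : IsDegZero 𝒜 w v (-B) :=
  fun i j => neg_mem (hB i j)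

theorem isDegZero_zero {ι κ : Type*} (w : ι → Gr n) (v : κ → Gr n) :
    IsDegZero 𝒜 w v (0 : Matrix ι κ A) :=
  fun _ _ => zero_mem _

variable [GradedAlgebra 𝒜]

variable {𝒜} in
theorem IsDegZero.mul {ι κ ρ : Type*} [Fintype κ] {w : ι → Gr n} {v : κ → Gr n} {x : ρ → Gr n}
    {B : Matrix ι κ A} {C : Matrix κ ρ A}
    (hB : IsDegZero 𝒜 w v B) (hC : IsDegZero 𝒜 v x C) : IsDegZero 𝒜 w x (B * C) :=
  mul_entry_mem 𝒜 w v x B C hB hC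

section Odd

variable {ι κ : Type*} [Fintype ι] [Fintype κ] [DecidableEq ι] [DecidableEq κ]

variable {𝒜} {w : ι → Gr n} {v : κ → Gr n}

/-- The matrix `1 + B C` of degree zero. -/
def oneAddMul {B : Matrix ι κ A} {C : Matrix κ ι A} (hB : IsDegZero 𝒜 w v B)
    (hC : IsDegZero 𝒜 v w C) : degZero 𝒜 w :=
  1 + ⟨B * C, hB.mul hC⟩

theorem oneAddMul_val {ι κ : Type*} [Fintype ι] [Fintype κ] [DecidableEq ι] {w : ι → Gr n}
    {v : κ → Gr n} {B : Matrix ι κ A} {C : Matrix κ ι A} (hB : IsDegZero 𝒜 w v B)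
    (hC : IsDegZero 𝒜 v w C) : (oneAddMul hB hC).1 = 1 + B * C := rfl

variable (𝒜 w v) in
/-- For every `C` the matrices `1 + B C` and `1 + C B` are invertible, and their graded
determinants are inverse to each other. -/
def HasInverseDets [IsGradedComm 𝒜] (B : Matrix ι κ A) : Prop :=
  ∃ hB : IsDegZero 𝒜 w v B, ∀ (C : Matrix κ ι A) (hC : IsDegZero 𝒜 v w C),
    IsUnit (oneAddMul hB hC) ∧ IsUnit (oneAddMul hC hB) ∧
      gdet 𝒜 (oneAddMul hB hC) * gdet 𝒜 (oneAddMul hC hB) = 1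

theorem hasInverseDets_zero [IsGradedComm 𝒜] (hw : ∀ i j, parity (w i + w j) = 0)
    (hv : ∀ i j, parity (v i + v j) = 0) : HasInverseDets 𝒜 w v 0 := by
  refine ⟨isDegZero_zero 𝒜 w v, fun C hC => ?_⟩
  have h1 : oneAddMul (isDegZero_zero 𝒜 w v) hC = 1 :=
    Subtype.ext (by simp [oneAddMul_val])
  have h2 : oneAddMul hC (isDegZero_zero 𝒜 w v) = 1 :=
    Subtype.ext (by simp [oneAddMul_val])
  rw [h1, h2, gdet_one 𝒜 hw, gdet_one 𝒜 hv]
  simp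

/-- With `C' = C (1 + B' C)⁻¹ = (1 + C B')⁻¹ C` one has
`1 + (B + B') C = (1 + B C') (1 + B' C)` and `1 + C (B + B') = (1 + C B') (1 + C' B)`. -/
theorem HasInverseDets.add [IsGradedComm 𝒜] (hw : ∀ i j, parity (w i + w j) = 0)
    (hv : ∀ i j, parity (v i + v j) = 0) {B B' : Matrix ι κ A}
    (h : HasInverseDets 𝒜 w v B) (h' : HasInverseDets 𝒜 w v B') :
    HasInverseDets 𝒜 w v (B + B') := by
  obtain ⟨hB, h⟩ := h
  obtain ⟨hB', h'⟩ := h'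
  refine ⟨hB.add hB', fun C hC => ?_⟩
  obtain ⟨⟨u, hu⟩, u2, e⟩ := h' C hC
  have hN : IsDegZero 𝒜 w w (u⁻¹).1.1 := (u⁻¹).1.2
  set N : Matrix ι ι A := (u⁻¹).1.1
  have hN1 : N * (1 + B' * C) = 1 := by
    rw [← oneAddMul_val hB' hC, ← hu]
    exact congrArg Subtype.val u.inv_mul
  have hN2 : (1 + B' * C) * N = 1 := by
    rw [← oneAddMul_val hB' hC, ← hu]
    exact congrArg Subtype.val u.mul_inv
  have hC' : IsDegZero 𝒜 v w (C * N) := hC.mul hN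
  obtain ⟨a1, a2, a3⟩ := h (C * N) hC'
  have e1 : oneAddMul (hB.add hB') hC =
      oneAddMul hB hC' * oneAddMul hB' hC := by
    apply Subtype.ext
    rw [Subring.coe_mul, oneAddMul_val, oneAddMul_val, oneAddMul_val, Matrix.add_mul 1,
      Matrix.one_mul, Matrix.mul_assoc, Matrix.mul_assoc, hN1, Matrix.mul_one, Matrix.add_mul]
    abel
  have e2 : oneAddMul hC (hB.add hB') =
      oneAddMul hC hB' * oneAddMul hC' hB := by
    apply Subtype.ext
    have hc : (1 + C * B') * (C * N) = C := by
      rw [Matrix.add_mul, Matrix.one_mul, Matrix.mul_assoc, ← Matrix.mul_assoc B',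
        ← Matrix.mul_add]
      conv_rhs => rw [← Matrix.mul_one C, ← hN2, Matrix.add_mul, Matrix.one_mul]
    rw [Subring.coe_mul, oneAddMul_val, oneAddMul_val, oneAddMul_val, Matrix.mul_add,
      Matrix.mul_add (1 + C * B'), Matrix.mul_one, ← Matrix.mul_assoc, hc]
    abel
  rw [e1, e2, gdet_mul 𝒜 hw, gdet_mul 𝒜 hv]
  refine ⟨a1.mul ⟨u, hu⟩, u2.mul a2, ?_⟩
  linear_combination e * gdet 𝒜 (oneAddMul hB hC') * gdet 𝒜 (oneAddMul hC' hB) + a3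

/-- If `B` has a single nonzero entry `b`, then `x = b c` for an entry `c` of `C` satisfies
`x ^ 2 = 0`, and the two determinants are `1 + x` and `1 - x`. -/
theorem hasInverseDets_single [CharZero K] [IsGradedComm 𝒜]
    (hw : ∀ i j, parity (w i + w j) = 0) (hv : ∀ i j, parity (v i + v j) = 0)
    {i : ι} {j : κ} (hij : parity (w i + v j) = 1) {b : A} (hb : b ∈ 𝒜 (w i + v j)) :
    HasInverseDets 𝒜 w v (Matrix.single i j b) := by
  have hB : IsDegZero 𝒜 w v (Matrix.single i j b) := by
    intro k l
    by_cases h : i = k ∧ j = l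
    · obtain ⟨rfl, rfl⟩ := h
      rwa [Matrix.single_apply_same]
    · rw [Matrix.single_apply_of_ne _ _ _ _ _ h]
      exact zero_mem _
  refine ⟨hB, fun C hC => ?_⟩
  have hc : C j i ∈ 𝒜 (w i + v j) := by rw [add_comm]; exact hC j i
  obtain ⟨hcb, hbcb⟩ := odd_mul_mul_self 𝒜 hij hb hc
  set B := Matrix.single i j b with hBdef
  have hBCB : B * C * B = 0 := by
    rw [hBdef, Matrix.single_mul_mul_single, hbcb, Matrix.single_zero]
  have u1 : IsUnit (oneAddMul hB hC) := by
    refine IsNilpotent.isUnit_one_add ⟨2, Subtype.ext ?_⟩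
    rw [pow_two]
    change B * C * (B * C) = 0
    rw [← Matrix.mul_assoc, hBCB, Matrix.zero_mul]
  have u2 : IsUnit (oneAddMul hC hB) := by
    refine IsNilpotent.isUnit_one_add ⟨2, Subtype.ext ?_⟩
    rw [pow_two]
    change C * B * (C * B) = 0
    rw [Matrix.mul_assoc, ← Matrix.mul_assoc B, hBCB, Matrix.mul_zero]
  refine ⟨u1, u2, ?_⟩
  have m1 : (oneAddMul hB hC).1 i i ∈ 𝒜 0 := by
    simpa [gr_add_self] using (oneAddMul hB hC).2 i i
  have m2 : (oneAddMul hC hB).1 j j ∈ 𝒜 0 := by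
    simpa [gr_add_self] using (oneAddMul hC hB).2 j j
  have d1 := gdet_of_row 𝒜 hw (oneAddMul hB hC) i (fun k l hk => by
    rw [oneAddMul_val, Matrix.add_apply, hBdef, Matrix.single_mul_apply_of_ne _ _ _ _ _ hk,
      add_zero]) m1
  have d2 := gdet_of_col 𝒜 hv (oneAddMul hC hB) j (fun k l hl => by
    rw [oneAddMul_val, Matrix.add_apply, hBdef, Matrix.mul_single_apply_of_ne _ _ _ _ _ hl,
      add_zero]) m2
  rw [d1, d2]
  apply Subtype.ext
  change (1 + B * C : Matrix ι ι A) i i * (1 + C * B : Matrix κ κ A) j j = 1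
  rw [Matrix.add_apply, Matrix.add_apply, Matrix.one_apply_eq, Matrix.one_apply_eq, hBdef,
    Matrix.single_mul_apply_same, Matrix.mul_single_apply_same, hcb]
  have : b * C j i * (b * C j i) = 0 := by rw [← mul_assoc, hbcb, zero_mul]
  simp [mul_add, add_mul, this]

/-- For rows of one parity and columns of the other, every matrix of degree zero satisfies
`HasInverseDets`, being a sum of matrices with a single entry. -/
theorem hasInverseDets [CharZero K] [IsGradedComm 𝒜]
    (hw : ∀ i j, parity (w i + w j) = 0) (hv : ∀ i j, parity (v i + v j) = 0)
    (hwv : ∀ i j, parity (w i + v j) = 1) {B : Matrix ι κ A} (hB : IsDegZero 𝒜 w v B) :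
    HasInverseDets 𝒜 w v B := by
  rw [Matrix.matrix_eq_sum_single B]
  have ha := fun B B' => HasInverseDets.add (𝒜 := 𝒜) hw hv (B := B) (B' := B')
  have h0 := hasInverseDets_zero (𝒜 := 𝒜) hw hv
  exact Finset.sum_induction _ _ ha h0 fun i _ => Finset.sum_induction _ _ ha h0 fun j _ =>
    hasInverseDets_single hw hv (hwv i j) (hB i j)

end Odd

/-! ### The decomposition into even and odd blocks -/

section Berezinian

variable {𝒜} {r : Gr n → ℕ}

theorem parity_pwt_add (ε : ZMod 2) (i j : PIdx r ε) : parity (pwt r ε i + pwt r ε j) = 0 :=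
  parity_add_of_eq i.2 j.2

theorem parity_pwt_add_pwt {ε δ : ZMod 2} (h : ε + δ = 1) (i : PIdx r ε) (j : PIdx r δ) :
    parity (pwt r ε i + pwt r δ j) = 1 := by
  rw [parity_add, i.2, j.2, h]

theorem isDegZero_blk (X : degZero 𝒜 (wt r)) (ε δ : ZMod 2) :
    IsDegZero 𝒜 (pwt r ε) (pwt r δ) (blk X ε δ) := fun i j => X.2 i.1 j.1

theorem blk_mul (X Y : degZero 𝒜 (wt r)) (ε δ : ZMod 2) :
    blk (X * Y) ε δ = blk X ε 0 * blk Y 0 δ + blk X ε 1 * blk Y 1 δ := by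
  ext i j
  change (X.1 * Y.1) i.1 j.1 = _
  rw [Matrix.mul_apply, ← Fintype.sum_fiberwise (fun k : Idx r => parity k.1)]
  exact Fin.sum_univ_two _

theorem blk_one_self (ε : ZMod 2) : blk (1 : degZero 𝒜 (wt r)) ε ε = 1 := by
  ext i j
  change (1 : Matrix _ _ A) i.1 j.1 = _
  simp [Matrix.one_apply, Subtype.ext_iff]

theorem blk_one_of_ne {ε δ : ZMod 2} (h : ε ≠ δ) : blk (1 : degZero 𝒜 (wt r)) ε δ = 0 := by
  ext i j
  refine Matrix.one_apply_ne fun e => h ?_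
  rw [← i.2, ← j.2, e]

theorem blk_ext {X Y : degZero 𝒜 (wt r)} (h : ∀ ε δ, blk X ε δ = blk Y ε δ) : X = Y := by
  apply Subtype.ext
  ext i j
  exact congrFun (congrFun (h (parity i.1) (parity j.1)) ⟨i, rfl⟩) ⟨j, rfl⟩

/-- The matrix of degree zero whose block at `(ε, δ)` is `B` and whose other blocks vanish. -/
def offBlk {ε δ : ZMod 2} {B : Matrix (PIdx r ε) (PIdx r δ) A}
    (hB : IsDegZero 𝒜 (pwt r ε) (pwt r δ) B) : degZero 𝒜 (wt r) :=
  ⟨fun i j => if h : parity i.1 = ε ∧ parity j.1 = δ then B ⟨i, h.1⟩ ⟨j, h.2⟩ else 0, fun i j => by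
    dsimp only
    split_ifs with h
    · exact hB ⟨i, h.1⟩ ⟨j, h.2⟩
    · exact zero_mem _⟩

theorem blk_offBlk_self {ε δ : ZMod 2} {B : Matrix (PIdx r ε) (PIdx r δ) A}
    (hB : IsDegZero 𝒜 (pwt r ε) (pwt r δ) B) : blk (offBlk hB) ε δ = B := by
  ext i j
  exact dif_pos ⟨i.2, j.2⟩

theorem blk_offBlk_of_ne {ε δ ε' δ' : ZMod 2} {B : Matrix (PIdx r ε) (PIdx r δ) A}
    (hB : IsDegZero 𝒜 (pwt r ε) (pwt r δ) B) (h : ¬(ε' = ε ∧ δ' = δ)) :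
    blk (offBlk hB) ε' δ' = 0 := by
  ext i j
  exact dif_neg fun e => h ⟨i.2.symm.trans e.1, j.2.symm.trans e.2⟩

theorem offBlk_mul_offBlk {ε δ : ZMod 2} (h : ε ≠ δ) {B B' : Matrix (PIdx r ε) (PIdx r δ) A}
    (hB : IsDegZero 𝒜 (pwt r ε) (pwt r δ) B) (hB' : IsDegZero 𝒜 (pwt r ε) (pwt r δ) B') :
    offBlk hB * offBlk hB' = 0 := by
  refine blk_ext fun ε' δ' => ?_
  rw [blk_mul]
  have key : ∀ η : ZMod 2, blk (offBlk hB) ε' η * blk (offBlk hB') η δ' = 0 := by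
    intro η
    by_cases e : η = δ
    · rw [blk_offBlk_of_ne hB' fun e' => h (e'.1.symm.trans e), Matrix.mul_zero]
    · rw [blk_offBlk_of_ne hB fun e' => e e'.2, Matrix.zero_mul]
  rw [key, key, add_zero]
  rfl

/-- The unitriangular matrix with identity diagonal blocks and off-diagonal block `B`. -/
def unipotent {ε δ : ZMod 2} (h : ε ≠ δ) {B : Matrix (PIdx r ε) (PIdx r δ) A}
    (hB : IsDegZero 𝒜 (pwt r ε) (pwt r δ) B) : GL0 𝒜 r where
  val := 1 + offBlk hB
  inv := 1 - offBlk hB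
  val_inv := by
    rw [mul_sub, mul_one, add_mul, offBlk_mul_offBlk h, one_mul, add_zero, add_sub_cancel_right]
  inv_val := by
    rw [mul_add, mul_one, sub_mul, offBlk_mul_offBlk h, one_mul, sub_zero, sub_add_cancel]

theorem blk_unipotent {ε δ : ZMod 2} (h : ε ≠ δ) {B : Matrix (PIdx r ε) (PIdx r δ) A}
    (hB : IsDegZero 𝒜 (pwt r ε) (pwt r δ) B) :
    blk (unipotent h hB).1 ε ε = 1 ∧ blk (unipotent h hB).1 δ δ = 1 ∧
      blk (unipotent h hB).1 ε δ = B ∧ blk (unipotent h hB).1 δ ε = 0 := by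
  have e : ∀ ε' δ', blk (unipotent h hB).1 ε' δ' = blk 1 ε' δ' + blk (offBlk hB) ε' δ' :=
    fun _ _ => rfl
  refine ⟨?_, ?_, ?_, ?_⟩
  · rw [e, blk_offBlk_of_ne hB fun e => h e.2, blk_one_self, add_zero]
  · rw [e, blk_offBlk_of_ne hB fun e => h e.1.symm, blk_one_self, add_zero]
  · rw [e, blk_offBlk_self hB, blk_one_of_ne h, zero_add]
  · rw [e, blk_offBlk_of_ne hB fun e => h e.2, blk_one_of_ne h.symm, zero_add]

/-- The inverse of the odd-odd diagonal block, with the junk value `0` if this block is not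
invertible. -/
noncomputable def invOdd (X : degZero 𝒜 (wt r)) : Matrix (PIdx r 1) (PIdx r 1) A :=
  (Ring.inverse (diagBlk X 1)).1

theorem isDegZero_invOdd (X : degZero 𝒜 (wt r)) :
    IsDegZero 𝒜 (pwt r 1) (pwt r 1) (invOdd X) := (Ring.inverse (diagBlk X 1)).2

theorem invOdd_mul {X : degZero 𝒜 (wt r)} (h : IsUnit (diagBlk X 1)) :
    invOdd X * blk X 1 1 = 1 := congrArg Subtype.val (Ring.inverse_mul_cancel _ h)

theorem mul_invOdd {X : degZero 𝒜 (wt r)} (h : IsUnit (diagBlk X 1)) :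
    blk X 1 1 * invOdd X = 1 := congrArg Subtype.val (Ring.mul_inverse_cancel _ h)

theorem quasidet_val (X : degZero 𝒜 (wt r)) :
    (quasidet X).1 = blk X 0 0 - blk X 0 1 * invOdd X * blk X 1 0 := rfl

variable [IsGradedComm 𝒜]

variable (𝒜) (r) in
/-- The graded determinant as a monoid homomorphism on the diagonal blocks of one parity. -/
noncomputable def gdetHom (ε : ZMod 2) : degZero 𝒜 (pwt r ε) →* 𝒜 0 where
  toFun := gdet 𝒜
  map_one' := gdet_one 𝒜 (parity_pwt_add ε)
  map_mul' := gdet_mul 𝒜 (parity_pwt_add ε)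

theorem isUnit_gdet {ε : ZMod 2} {Y : degZero 𝒜 (pwt r ε)} (h : IsUnit Y) :
    IsUnit (gdet 𝒜 Y) := h.map (gdetHom 𝒜 r ε)

/-- For odd blocks `B` and `C` in opposite positions, `1 + B C` and `1 + C B` are invertible
with inverse determinants. -/
theorem odd_blocks [CharZero K] {ε δ : ZMod 2} (hεδ : ε + δ = 1)
    {B : Matrix (PIdx r ε) (PIdx r δ) A} {C : Matrix (PIdx r δ) (PIdx r ε) A}
    (hB : IsDegZero 𝒜 (pwt r ε) (pwt r δ) B) (hC : IsDegZero 𝒜 (pwt r δ) (pwt r ε) C) :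
    IsUnit (oneAddMul hB hC) ∧ IsUnit (oneAddMul hC hB) ∧
      gdet 𝒜 (oneAddMul hB hC) * gdet 𝒜 (oneAddMul hC hB) = 1 :=
  (hasInverseDets (parity_pwt_add ε) (parity_pwt_add δ) (parity_pwt_add_pwt hεδ) hB).2 C hC

/-- If `X Y = 1`, the product of the diagonal blocks of one parity is `1 + B C` with odd
`B = -X_{ε, ε + 1}` and `C = Y_{ε + 1, ε}`. -/
theorem isUnit_diagBlk_mul [CharZero K] {X Y : degZero 𝒜 (wt r)} (h : X * Y = 1) (ε : ZMod 2) :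
    IsUnit (diagBlk X ε * diagBlk Y ε) := by
  have hne : ∀ ε : ZMod 2, ε + (ε + 1) = 1 := by decide
  have hB : IsDegZero 𝒜 (pwt r ε) (pwt r (ε + 1)) (-blk X ε (ε + 1)) :=
    (isDegZero_blk X _ _).neg
  have hu := (odd_blocks (hne ε) hB (isDegZero_blk Y (ε + 1) ε)).1
  convert hu using 1
  apply Subtype.ext
  change blk X ε ε * blk Y ε ε = 1 + -blk X ε (ε + 1) * blk Y (ε + 1) ε
  have hs : blk (X * Y) ε ε = blk X ε ε * blk Y ε ε + blk X ε (ε + 1) * blk Y (ε + 1) ε := by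
    rw [blk_mul]
    fin_cases ε
    · rfl
    · exact add_comm _ _
  rw [h, blk_one_self] at hs
  rw [hs, Matrix.neg_mul]
  abel

theorem isUnit_diagBlk [CharZero K] (X : GL0 𝒜 r) (ε : ZMod 2) : IsUnit (diagBlk X.1 ε) := by
  have h1 := isUnit_diagBlk_mul (X := X.1) (Y := (X⁻¹).1) X.mul_inv ε
  have h2 := isUnit_diagBlk_mul (X := (X⁻¹).1) (Y := X.1) X.inv_mul ε
  obtain ⟨u, hu⟩ := h1
  obtain ⟨v, hv⟩ := h2
  refine isUnit_iff_exists_and_exists.2 ⟨⟨diagBlk (X⁻¹).1 ε * ↑u⁻¹, ?_⟩,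
    ⟨↑v⁻¹ * diagBlk (X⁻¹).1 ε, ?_⟩⟩
  · rw [← mul_assoc]; erw [← hu]; exact u.mul_inv
  · rw [mul_assoc]; erw [← hv]; exact v.inv_mul

/-! ### The graded Berezinian -/

/-- The value `Γdet(|X|₁₁) Γdet(X₂₂)⁻¹` of the graded Berezinian; it is meaningful if `X₂₂` is
invertible, since otherwise `Ring.inverse` takes the junk value `0`. -/
noncomputable def berValue (X : degZero 𝒜 (wt r)) : 𝒜 0 :=
  gdet 𝒜 (quasidet X) * Ring.inverse (gdet 𝒜 (diagBlk X 1))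


/-- The Schur complement of a product. The factors have the blocks `S + B * Ct`, `B`, `D * Ct`, `D`
and `S' + Bt * C'`, `Bt * D'`, `C'`, `D'`, so that `S` and `S'` are their Schur complements. With
`E` the inverse of `1 + Ct * Bt`, the matrix `1 - Bt * E * Ct` is the inverse of `1 + Bt * Ct`. -/
theorem schur_mul {p q R : Type*} [Fintype p] [Fintype q] [DecidableEq p] [DecidableEq q] [Ring R]
    (S S' : Matrix p p R) (B Bt : Matrix p q R) (Ct C' : Matrix q p R)
    {D D' Di Di' E : Matrix q q R} (hD : Di * D = 1) (hD' : D' * Di' = 1)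
    (hE : (1 + Ct * Bt) * E = 1) (hE' : E * (1 + Ct * Bt) = 1) :
    (S + B * Ct) * (S' + Bt * C') + B * C' -
      ((S + B * Ct) * (Bt * D') + B * D') * (Di' * E * Di) *
        (D * Ct * (S' + Bt * C') + D * C') =
      S * (1 - Bt * E * Ct) * S' := by
  have h1 : (S + B * Ct) * (Bt * D') + B * D' = (S * Bt + B * (1 + Ct * Bt)) * D' := by
    simp only [Matrix.add_mul, Matrix.mul_add, Matrix.mul_assoc, Matrix.mul_one]
    abel
  have h2 : D * Ct * (S' + Bt * C') + D * C' = D * (Ct * S' + (1 + Ct * Bt) * C') := by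
    simp only [Matrix.add_mul, Matrix.mul_add, Matrix.mul_assoc, Matrix.one_mul]
    abel
  have h3 : ((S * Bt + B * (1 + Ct * Bt)) * D') * (Di' * E * Di) *
      (D * (Ct * S' + (1 + Ct * Bt) * C')) =
      (S * Bt + B * (1 + Ct * Bt)) * E * (Ct * S' + (1 + Ct * Bt) * C') := by
    calc _ = (S * Bt + B * (1 + Ct * Bt)) * ((D' * Di') * (E * ((Di * D) *
          (Ct * S' + (1 + Ct * Bt) * C')))) := by simp only [Matrix.mul_assoc]
      _ = _ := by rw [hD, hD', Matrix.one_mul, Matrix.one_mul, Matrix.mul_assoc]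
  have h4 : (S * Bt + B * (1 + Ct * Bt)) * E * (Ct * S' + (1 + Ct * Bt) * C') =
      S * Bt * E * Ct * S' + S * Bt * C' + B * Ct * S' + B * (1 + Ct * Bt) * C' := by
    calc _ = S * Bt * E * Ct * S' + S * Bt * (E * (1 + Ct * Bt)) * C' +
          B * ((1 + Ct * Bt) * E) * (Ct * S' + (1 + Ct * Bt) * C') := by
          rw [Matrix.add_mul, Matrix.add_mul, Matrix.mul_add (S * Bt * E)]
          simp only [Matrix.mul_assoc]
      _ = _ := by
          rw [hE, hE', Matrix.mul_one, Matrix.mul_one, Matrix.mul_add]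
          simp only [Matrix.mul_assoc]
          abel
  rw [h1, h2, h3, h4]
  simp only [Matrix.add_mul, Matrix.mul_add, Matrix.mul_sub, Matrix.sub_mul, Matrix.mul_assoc,
    Matrix.mul_one]
  abel

theorem berValue_mul [CharZero K] {X Y : degZero 𝒜 (wt r)} (hX : IsUnit (diagBlk X 1))
    (hY : IsUnit (diagBlk Y 1)) : berValue (X * Y) = berValue X * berValue Y := by
  have hBt : IsDegZero 𝒜 (pwt r 0) (pwt r 1) (blk Y 0 1 * invOdd Y) :=
    (isDegZero_blk Y 0 1).mul (isDegZero_invOdd Y)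
  have hCt : IsDegZero 𝒜 (pwt r 1) (pwt r 0) (invOdd X * blk X 1 0) :=
    (isDegZero_invOdd X).mul (isDegZero_blk X 1 0)
  obtain ⟨-, hF, e⟩ := odd_blocks (zero_add 1) hBt hCt
  set Bt := blk Y 0 1 * invOdd Y with hBtdef
  set Ct := invOdd X * blk X 1 0 with hCtdef
  obtain ⟨u, hu⟩ := hF
  set E := (u⁻¹).1
  have hE : (1 + Ct * Bt) * E.1 = 1 := by
    rw [← oneAddMul_val hCt hBt, ← hu]; exact congrArg Subtype.val u.mul_inv
  have hE' : E.1 * (1 + Ct * Bt) = 1 := by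
    rw [← oneAddMul_val hCt hBt, ← hu]; exact congrArg Subtype.val u.inv_mul
  have hB' : blk Y 0 1 = Bt * blk Y 1 1 := by
    rw [hBtdef, Matrix.mul_assoc, invOdd_mul hY, Matrix.mul_one]
  have hC : blk X 1 0 = blk X 1 1 * Ct := by
    rw [hCtdef, ← Matrix.mul_assoc, mul_invOdd hX, Matrix.one_mul]
  have hodd : diagBlk (X * Y) 1 = diagBlk X 1 * oneAddMul hCt hBt * diagBlk Y 1 := by
    apply Subtype.ext
    change blk (X * Y) 1 1 = blk X 1 1 * (1 + Ct * Bt) * blk Y 1 1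
    rw [blk_mul, hC, hB', Matrix.mul_add, Matrix.mul_one, Matrix.add_mul, add_comm]
    simp only [Matrix.mul_assoc]
  have hinv : invOdd (X * Y) = invOdd Y * E.1 * invOdd X := by
    obtain ⟨x, hx⟩ := hX
    obtain ⟨y, hy⟩ := hY
    rw [invOdd, invOdd, invOdd, hodd, ← hu, ← hx, ← hy, ← Units.val_mul, ← Units.val_mul,
      Ring.inverse_unit, Ring.inverse_unit, Ring.inverse_unit, mul_inv_rev, mul_inv_rev,
      ← mul_assoc]
    rfl
  -- `N` is the inverse of `1 + Bt * Ct`, written through the inverse `E` of `1 + Ct * Bt`.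
  let N : degZero 𝒜 (pwt r 0) := 1 - ⟨Bt * E.1 * Ct, (hBt.mul E.2).mul hCt⟩
  have hNval : N.1 = 1 - Bt * E.1 * Ct := rfl
  have hN : N * oneAddMul hBt hCt = 1 := by
    apply Subtype.ext
    change (1 - Bt * E.1 * Ct) * (1 + Bt * Ct) = 1
    have h : Bt * E.1 * Ct * (1 + Bt * Ct) = Bt * (E.1 * (1 + Ct * Bt)) * Ct := by
      simp only [Matrix.mul_add, Matrix.add_mul, Matrix.mul_assoc, Matrix.mul_one]
    rw [Matrix.sub_mul, h, hE', Matrix.mul_one, Matrix.one_mul, add_sub_cancel_right]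
  have heven : quasidet (X * Y) = quasidet X * N * quasidet Y := by
    apply Subtype.ext
    change (quasidet (X * Y)).1 = (quasidet X).1 * (1 - Bt * E.1 * Ct) * (quasidet Y).1
    have hA : blk X 0 0 = (quasidet X).1 + blk X 0 1 * Ct := by
      rw [quasidet_val, hCtdef, Matrix.mul_assoc, sub_add_cancel]
    have hA' : blk Y 0 0 = (quasidet Y).1 + Bt * blk Y 1 0 := by
      rw [quasidet_val, hBtdef, sub_add_cancel]
    rw [quasidet_val, hinv, blk_mul, blk_mul, blk_mul, hC, hB', hA, hA']
    exact schur_mul _ _ _ _ _ _ (invOdd_mul hX) (mul_invOdd hY) hE hE'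
  have g := congrArg (gdet 𝒜) hN
  rw [gdet_mul 𝒜 (parity_pwt_add 0), gdet_one 𝒜 (parity_pwt_add 0)] at g
  have hf : IsUnit (gdet 𝒜 (oneAddMul hCt hBt)) := isUnit_gdet ⟨u, hu⟩
  have hNf : gdet 𝒜 N = gdet 𝒜 (oneAddMul hCt hBt) := by
    linear_combination gdet 𝒜 (oneAddMul hCt hBt) * g - gdet 𝒜 N * e
  rw [berValue, heven, hodd, gdet_mul 𝒜 (parity_pwt_add 0), gdet_mul 𝒜 (parity_pwt_add 0),
    gdet_mul 𝒜 (parity_pwt_add 1), gdet_mul 𝒜 (parity_pwt_add 1), Ring.mul_inverse_rev,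
    Ring.mul_inverse_rev, hNf, berValue, berValue]
  have hff := Ring.mul_inverse_cancel _ hf
  linear_combination (gdet 𝒜 (quasidet X) * gdet 𝒜 (quasidet Y) *
    Ring.inverse (gdet 𝒜 (diagBlk X 1)) * Ring.inverse (gdet 𝒜 (diagBlk Y 1))) * hff

theorem berValue_of_blk_eq_zero {X : degZero 𝒜 (wt r)}
    (h : blk X 0 1 = 0 ∨ blk X 1 0 = 0) :
    berValue X = gdet 𝒜 (diagBlk X 0) * Ring.inverse (gdet 𝒜 (diagBlk X 1)) := by
  have hq : quasidet X = diagBlk X 0 := by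
    apply Subtype.ext
    rw [quasidet_val]
    change _ = blk X 0 0
    rcases h with h | h <;> simp [h]
  rw [berValue, hq]

theorem berValue_unitriangular {X : degZero 𝒜 (wt r)} (h0 : blk X 0 0 = 1) (h1 : blk X 1 1 = 1)
    (h : blk X 0 1 = 0 ∨ blk X 1 0 = 0) : berValue X = 1 := by
  have e0 : diagBlk X 0 = 1 := Subtype.ext h0
  have e1 : diagBlk X 1 = 1 := Subtype.ext h1
  rw [berValue_of_blk_eq_zero h, e0, e1, gdet_one 𝒜 (parity_pwt_add 0),
    gdet_one 𝒜 (parity_pwt_add 1), Ring.inverse_one, mul_one]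

variable (𝒜) (r) in
/-- The graded Berezinian. Its values are units because `berValue` is multiplicative on the group
`GL0 𝒜 r`. -/
noncomputable def gber [CharZero K] : GL0 𝒜 r →* (𝒜 0)ˣ :=
  MonoidHom.toHomUnits
    { toFun := fun X => berValue X.1
      map_one' := berValue_unitriangular (blk_one_self 0) (blk_one_self 1)
        (Or.inl (blk_one_of_ne zero_ne_one))
      map_mul' := fun X Y => berValue_mul (isUnit_diagBlk X 1) (isUnit_diagBlk Y 1) }

theorem isGradedBer_gber [CharZero K] : IsGradedBer (gber 𝒜 r) := by
  refine ⟨fun X h _ => berValue_of_blk_eq_zero (Or.inl h), fun X h0 h1 h => Units.ext ?_,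
    fun X h0 h1 h => Units.ext ?_⟩
  · exact berValue_unitriangular h0 h1 (Or.inl h)
  · exact berValue_unitriangular h0 h1 (Or.inr h)

/-- Multiplication by unitriangular matrices turns `X` into the block-diagonal matrix with the
blocks `|X|₁₁` and `X₂₂`. -/
theorem IsGradedBer.eq_berValue [CharZero K] {φ : GL0 𝒜 r →* (𝒜 0)ˣ} (hφ : IsGradedBer φ)
    (X : GL0 𝒜 r) : (φ X : 𝒜 0) = berValue X.1 := by
  obtain ⟨hdiag, hlow, hup⟩ := hφ
  have hD : IsUnit (diagBlk X.1 1) := isUnit_diagBlk X 1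
  have hB : IsDegZero 𝒜 (pwt r 0) (pwt r 1) (-(blk X.1 0 1 * invOdd X.1)) :=
    ((isDegZero_blk X.1 0 1).mul (isDegZero_invOdd X.1)).neg
  have hC : IsDegZero 𝒜 (pwt r 1) (pwt r 0) (-(invOdd X.1 * blk X.1 1 0)) :=
    ((isDegZero_invOdd X.1).mul (isDegZero_blk X.1 1 0)).neg
  obtain ⟨u00, u11, u01, u10⟩ := blk_unipotent zero_ne_one hB
  obtain ⟨l11, l00, l10, l01⟩ := blk_unipotent one_ne_zero hC
  set U := unipotent zero_ne_one hB
  set L := unipotent one_ne_zero hC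
  have hφX : φ X = φ (U * X * L) := by
    rw [map_mul, map_mul, hup U u00 u11 u10, hlow L l00 l11 l01, one_mul, mul_one]
  have e : ∀ ε δ, blk (U * X * L).1 ε δ = blk (U.1 * X.1 * L.1) ε δ := fun _ _ => rfl
  have h01 : blk (U.1 * X.1) 0 1 = 0 := by
    rw [blk_mul, u00, u01, Matrix.one_mul, Matrix.neg_mul, Matrix.mul_assoc, invOdd_mul hD,
      Matrix.mul_one, add_neg_cancel]
  have h11 : blk (U.1 * X.1) 1 1 = blk X.1 1 1 := by
    rw [blk_mul, u10, u11, Matrix.one_mul, Matrix.zero_mul, zero_add]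
  have h00 : blk (U.1 * X.1) 0 0 = (quasidet X.1).1 := by
    rw [blk_mul, u00, u01, Matrix.one_mul, Matrix.neg_mul, quasidet_val, sub_eq_add_neg]
  have h10 : blk (U.1 * X.1) 1 0 = blk X.1 1 0 := by
    rw [blk_mul, u10, u11, Matrix.one_mul, Matrix.zero_mul, zero_add]
  have g00 : diagBlk (U * X * L).1 0 = quasidet X.1 := by
    apply Subtype.ext
    change blk (U.1 * X.1 * L.1) 0 0 = _
    rw [blk_mul, h00, h01, l00, Matrix.mul_one, Matrix.zero_mul, add_zero]
  have g11 : diagBlk (U * X * L).1 1 = diagBlk X.1 1 := by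
    apply Subtype.ext
    change blk (U.1 * X.1 * L.1) 1 1 = blk X.1 1 1
    rw [blk_mul, h11, l11, l01, Matrix.mul_one, Matrix.mul_zero, zero_add]
  have g01 : blk (U * X * L).1 0 1 = 0 := by
    rw [e, blk_mul, h01, l01, Matrix.mul_zero, Matrix.zero_mul, add_zero]
  have g10 : blk (U * X * L).1 1 0 = 0 := by
    rw [e, blk_mul, h10, h11, l00, l10, Matrix.mul_one, Matrix.mul_neg, ← Matrix.mul_assoc,
      mul_invOdd hD, Matrix.one_mul, add_neg_cancel]
  rw [hφX, hdiag _ g01 g10, g00, g11, berValue]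

end Berezinian

end

end ColorBer

theorem theorem5p1 {K A : Type*} [Field K] [CharZero K] [Ring A] [Algebra K A] {n : ℕ}
    (𝒜 : ColorBer.Gr n → Submodule K A) [GradedAlgebra 𝒜] [ColorBer.IsGradedComm 𝒜]
    (r : ColorBer.Gr n → ℕ) :
    (∀ ε : ZMod 2,
      ColorBer.IsGradedDet 𝒜 (ColorBer.gdet 𝒜 : ColorBer.degZero 𝒜 (ColorBer.pwt r ε) → 𝒜 0)) ∧
    (∀ (X : ColorBer.GL0 𝒜 r) (ε : ZMod 2),
      IsUnit (ColorBer.diagBlk X.1 ε) ∧ IsUnit (ColorBer.gdet 𝒜 (ColorBer.diagBlk X.1 ε))) ∧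
    (∃! φ : ColorBer.GL0 𝒜 r →* (𝒜 0)ˣ, ColorBer.IsGradedBer φ) ∧
    (∀ φ : ColorBer.GL0 𝒜 r →* (𝒜 0)ˣ, ColorBer.IsGradedBer φ → ∀ X : ColorBer.GL0 𝒜 r,
      (φ X : 𝒜 0) = ColorBer.gdet 𝒜 (ColorBer.quasidet X.1) *
        Ring.inverse (ColorBer.gdet 𝒜 (ColorBer.diagBlk X.1 1))) := by
  refine ⟨fun ε => ColorBer.isGradedDet_gdet 𝒜 (ColorBer.parity_pwt_add ε),
    fun X ε => ⟨ColorBer.isUnit_diagBlk X ε, ColorBer.isUnit_gdet (ColorBer.isUnit_diagBlk X ε)⟩,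
    ⟨ColorBer.gber 𝒜 r, ColorBer.isGradedBer_gber, fun φ hφ => ?_⟩,
    fun φ hφ X => hφ.eq_berValue X⟩
  ext X : 2
  exact hφ.eq_berValue X
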